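/- Let $L\ge 1$ be an integer and let $J_X,J_Y,J_Z\in\mathbb C$. On $(\mathbb C^2)^{\otimes L}$ let $(M)_i$ denote the $2\times2$ matrix $M$ acting on site $i$, with site indices taken modulo $L$, let $X,Y,Z$ be the Pauli matrices, and let $$H=\sum_{i=1}^{L}\bigl[J_X X_iX_{i+1}+J_Y Y_iY_{i+1}+J_Z Z_iZ_{i+1}\bigr]$$ be the Hamiltonian of the periodic spin-$1/2$ XYZ chain. For a sequence $\boldsymbol A=A_1A_2\cdots A_l$ of $l\ge1$ letters in $\{X,Y,Z\}$ put $$D(\boldsymbol A)=\sum_{i=1}^{L}(A_1)_i\,(A_1A_2)_{i+1}\,(A_2A_3)_{i+2}\cdots(A_{l-1}A_l)_{i+l-1}\,(A_l)_{i+l},$$ the operators being multiplied in the order written. Write $\boldsymbol A=B_1^{m_1+1}B_2^{m_2+1}\cdots B_t^{m_t+1}$ with $B_r\ne B_{r+1}$ and $m_r\ge0$. The number of holes of $\boldsymbol A$ is $m=\sum_{r}m_r=l-t$, and $N^{\boldsymbol A}_X,N^{\boldsymbol A}_Y,N^{\boldsymbol A}_Z$ are the numbers of $X$, $Y$, $Z$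 among $B_1,\dots,B_t$. Let $$\overline{\boldsymbol A}=(-\mathrm i)^{t-1}D(\boldsymbol A),\qquad J_{\boldsymbol A}=(J_XJ_YJ_Z)^{m}\prod_{r=1}^{t}J_{B_r}^{1-m_r},$$ where $J_{\boldsymbol A}$ is read as a monomial in $J_X,J_Y,J_Z$ (all its exponents are non-negative). For integers $n,N_X,N_Y,N_Z\ge 0$ define $$S_n(N_X,N_Y,N_Z)=\sum_{\substack{n_X+n_Y+n_Z=n\\ n_X,n_Y,n_Z\ge0}}\ \prod_{a\in\{X,Y,Z\}}\binom{n_a+N_a-1}{N_a-1}J_a^{2n_a},$$ where for $N_a=0$ the binomial factor is $1$ if $n_a=0$ and $0$ if $n_a>0$, and $$R_n(N_X,N_Y,N_Z)=4S_n(N_X+n,N_Y+n,N_Z+n)-S_n(N_X+n+1,N_Y+n,N_Z+n)-S_n(N_X+n,N_Y+n+1,N_Z+n)-S_n(N_X+n,N_Y+n,N_Z+n+1).$$ For $k\ge2$ let $$Q_k=\sum_{\substack{n,m\ge0\\ n+m<\lfloor k/2\rfloor}}\ \sum_{\boldsymbol A\in\mathcal S_k^{n,m}}R_n\bigl(N^{\boldsymbol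 A}_X+m,\,N^{\boldsymbol A}_Y+m,\,N^{\boldsymbol A}_Z+m\bigr)\,J_{\boldsymbol A}\,\overline{\boldsymbol A},$$ where $\mathcal S_k^{n,m}$ is the set of all sequences of length $k-2n-m-1$ with exactly $m$ holes. Then, for every $k\ge2$, $$[Q_k,H]=0.$$ -/

import Mathlib

noncomputable section

namespace XYZChain

/-- The three letters `X`, `Y`, `Z`. -/
inductive Letter
  | X
  | Y
  | Z
  deriving DecidableEq

instance : Fintype Letter where
  elems := {Letter.X, Letter.Y, Letter.Z}
  complete := by intro a; cases a <;> decide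

/-- The Pauli matrix named by a letter. -/
def pauli : Letter → Matrix (Fin 2) (Fin 2) ℂ
  | Letter.X => !![0, 1; 1, 0]
  | Letter.Y => !![0, -Complex.I; Complex.I, 0]
  | Letter.Z => !![1, 0; 0, -1]

/-- Operators on `L` spins `1/2`: complex matrices indexed by the spin configurations of the
periodic chain, whose sites are the elements of `ZMod L`. -/
abbrev Op (L : ℕ) : Type := Matrix (ZMod L → Fin 2) (ZMod L → Fin 2) ℂ

section Operators

variable {L : ℕ} [NeZero L]

/-- The operator `(M)_i` acting as the `2 × 2` matrix `M` on site `i` and trivially elsewhere. -/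
def siteOp (i : ZMod L) (M : Matrix (Fin 2) (Fin 2) ℂ) : Op L :=
  Matrix.of fun s t => if ∀ j, j ≠ i → s j = t j then M (s i) (t i) else 0

/-- The XYZ Hamiltonian
`H = ∑ i, (J_X X_i X_{i+1} + J_Y Y_i Y_{i+1} + J_Z Z_i Z_{i+1})`, periodic boundary. -/
def hamiltonian (L : ℕ) [NeZero L] (J : Letter → ℂ) : Op L :=
  ∑ i : ZMod L, ∑ a : Letter, J a • (siteOp i (pauli a) * siteOp (i + 1) (pauli a))

/-- The matrix of the `j`-th letter `A_j` (`j = 1, …, l`) of a sequence, with `A_j = 1` (the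
identity matrix) for `j = 0` and `j > l`. -/
def padded {l : ℕ} (A : Fin l → Letter) (j : ℕ) : Matrix (Fin 2) (Fin 2) ℂ :=
  if h : 1 ≤ j ∧ j ≤ l then pauli (A ⟨j - 1, by omega⟩) else 1

/-- The doubling product of `A_1 … A_l` starting at site `i`:
`(A_1)_i (A_1 A_2)_{i+1} ⋯ (A_{l-1} A_l)_{i+l-1} (A_l)_{i+l}`, factors in this order. -/
def doublingAt {l : ℕ} (A : Fin l → Letter) (i : ZMod L) : Op L :=
  (List.ofFn fun j : Fin (l + 1) =>
    siteOp (i + ((j : ℕ) : ZMod L)) (padded A (j : ℕ) * padded A ((j : ℕ) + 1))).prod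

/-- The doubling product of a sequence of letters, summed over all translations. -/
def doubling (L : ℕ) [NeZero L] {l : ℕ} (A : Fin l → Letter) : Op L :=
  ∑ i : ZMod L, doublingAt A i

end Operators

section Sequences

variable {l : ℕ}

/-- Position `j` is a hole of the sequence: the next letter exists and is the same letter. -/
def IsHole (A : Fin l → Letter) (j : Fin l) : Prop :=
  ∃ h : (j : ℕ) + 1 < l, A j = A ⟨(j : ℕ) + 1, h⟩

instance (A : Fin l → Letter) (j : Fin l) : Decidable (IsHole A j) := by
  unfold IsHole; infer_instance

/-- The number `m` of holes. -/
def numHoles (A : Fin l → Letter) : ℕ :=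
  (Finset.univ.filter fun j => IsHole A j).card

/-- The number `t` of maximal blocks of equal letters; every block has exactly one position that
is not a hole, namely its last one. -/
def numBlocks (A : Fin l → Letter) : ℕ :=
  (Finset.univ.filter fun j => ¬ IsHole A j).card

/-- The number `N_a` of maximal blocks whose letter is `a`. -/
def blockCount (A : Fin l → Letter) (a : Letter) : ℕ :=
  (Finset.univ.filter fun j => ¬ IsHole A j ∧ A j = a).card

/-- The coupling factor `J_A = (J_X J_Y J_Z)^m ∏_r J_{B_r}^{1 - m_r}` of a sequence with blocks
`B_r^{m_r + 1}`, as a monomial without negative exponents (so that vanishing couplings are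
covered): a block contributes `J_B` once (at its last position), and each of its `m_r` holes
contributes `J_X J_Y J_Z / J_B`, the product of the two other couplings. -/
def coupling (J : Letter → ℂ) (A : Fin l → Letter) : ℂ :=
  ∏ j : Fin l, if IsHole A j then ∏ b ∈ Finset.univ.erase (A j), J b else J (A j)

/-- For nonzero couplings `coupling` is `(J_X J_Y J_Z)^m` times the product of the factors
`J_B^{1 - m_r}` over the blocks, each written as `J_B` (last position of the block) times
`m_r` factors `J_B⁻¹` (the holes of the block). -/
theorem coupling_eq (J : Letter → ℂ) (hJ : ∀ a, J a ≠ 0) (A : Fin l → Letter) :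
    coupling J A = (∏ b, J b) ^ numHoles A *
      ∏ j : Fin l, if IsHole A j then (J (A j))⁻¹ else J (A j) := by
  have h : (∏ b, J b) ^ numHoles A = ∏ j : Fin l, if IsHole A j then ∏ b, J b else 1 := by
    rw [← Finset.prod_filter, Finset.prod_const, numHoles]
  rw [h, ← Finset.prod_mul_distrib]
  refine Finset.prod_congr rfl fun j _ => ?_
  split_ifs
  · rw [← Finset.mul_prod_erase Finset.univ J (Finset.mem_univ (A j)), mul_right_comm,
      mul_inv_cancel₀ (hJ _), one_mul]
  · rw [one_mul]

end Sequences

/-- `S_n(N_X, N_Y, N_Z)`, the sum over `n_X + n_Y + n_Z = n` of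
`∏_a C(n_a + N_a - 1, N_a - 1) (J_a ^ 2) ^ n_a`. Here `Nat.multichoose N n` is
`C(n + N - 1, N - 1)` for `N ≥ 1`; for `N = 0` it is `1` if `n = 0` and `0` otherwise. -/
def sFunc (J : Letter → ℂ) (n : ℕ) (N : Letter → ℕ) : ℂ :=
  ∑ p ∈ Finset.piAntidiag (Finset.univ : Finset Letter) n,
    ∏ a : Letter, (Nat.multichoose (N a) (p a) : ℂ) * (J a ^ 2) ^ p a

/-- `R_n(N) = 4 S_n(N + n) - ∑_a S_n(N + n + e_a)`, where `N + n` adds `n` to each of the three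
components. -/
def rFunc (J : Letter → ℂ) (n : ℕ) (N : Letter → ℕ) : ℂ :=
  4 * sFunc J n (fun b => N b + n) -
    ∑ a : Letter, sFunc J n (fun b => N b + n + if b = a then 1 else 0)

/-- The charge `Q_k`: the sum over `n, m ≥ 0` with `n + m < ⌊k/2⌋` and over all sequences `A` of
`k - 2n - m - 1` letters with `m` holes of
`R_n(N^A + m) J_A (-i)^(t - 1)` times the doubling product of `A`. -/
def charge (L : ℕ) [NeZero L] (J : Letter → ℂ) (k : ℕ) : Op L :=
  ∑ n ∈ Finset.range (k / 2), ∑ m ∈ Finset.range (k / 2 - n),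
    ∑ A : Fin (k - 2 * n - m - 1) → Letter with numHoles A = m,
      (rFunc J n (fun a => blockCount A a + m) * coupling J A *
        (-Complex.I) ^ (numBlocks A - 1)) • doubling L A

end XYZChain

end

/-!
The doubling product of a sequence of letters is the ordered product of the bond operators
`bondOp i a = a_i a_{i+1}` along consecutive bonds (`doublingAt_eq`), and this holds on every
periodic chain, even if the product winds around it. The proof uses only two facts on the bond
operators: on one bond they multiply like Pauli matrices up to signs (`bondRelations`), and the
commutator of a bond operator with the Hamiltonian is `h_i K_{i+1} - K_{i-1} h_i`, where
`K = crossTerm` is a linear combination of operators on a neighbouring bond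
(`bondOp_lie_hamiltonian`). Both hold for `L ≥ 2`; for `L = 1` the Hamiltonian is a scalar.

All charges are generated by one series. Put `v_a = 1 - J_a² x` and let `t² = x v_X v_Y v_Z`. Give a
sequence of letters the weight in which a hole of letter `a` contributes `x ∏_{b ≠ a} J_b` and the
last position of a block of letter `a` contributes `-i t J_a / v_a`. Over `ℂ⟦z⟧`, with `x = z²`, the
sum `Q` of all weighted words of bond operators is determined by a linear recursion on the bonds
(`exists_generating_series`).

* The weights are local, so that `[Q, H] = 0` reduces to three identities in the algebra of one
  bond: `window_identity` for a letter with both neighbours given, `tail_identity` and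
  `head_identity` for the two ends of a word. With their help the commutator of `H` with a half-open
  word is found in closed form (`tail_lie`), and the commutator with `Q` telescopes around the chain
  (`lie_sum_eq_zero`).
* The charge `Q_k` is the image of `Q` under a linear functional, the coefficient of `z^(k-1)` after
  multiplication by `(v_X v_Y v_Z)^(-(k-1)/2) (4 - ∑ a, 1 / v_a)` (`extract_wordWeight`). This
  factor is the one of Lagrange inversion for `t² = x v_X v_Y v_Z`: morally `R_n` is the coefficient
  of `t^(2n)` in `∏ a, v_a^(-N_a)`. As the functional is linear and `H` does not involve `z`, it
  carries `[Q, H] = 0` to `[Q_k, H] = 0`.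
-/

noncomputable section

namespace XYZChain

/-! ### The three letters and the operators on one bond -/

/-- The letters `a`, `b`, `c` are pairwise distinct, that is, all three letters in some order. -/
structure Letter.Distinct (a b c : Letter) : Prop where
  ab : a ≠ b
  bc : b ≠ c
  ac : a ≠ c

namespace Letter.Distinct

variable {a b c : Letter}

theorem swap (h : Distinct a b c) : Distinct b a c := ⟨h.ab.symm, h.ac, h.bc⟩

theorem rotate (h : Distinct a b c) : Distinct b c a := ⟨h.bc, h.ac.symm, h.ab.symm⟩

theorem univ_eq (h : Distinct a b c) : (Finset.univ : Finset Letter) = {a, b, c} := by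
  obtain ⟨h1, h2, h3⟩ := h
  revert a b c; decide

theorem sum_eq (h : Distinct a b c) {M : Type*} [AddCommMonoid M] (f : Letter → M) :
    ∑ i, f i = f a + f b + f c := by
  rw [h.univ_eq, Finset.sum_insert (by simp [h.ab, h.ac]), Finset.sum_pair h.bc, add_assoc]

theorem prod_eq (h : Distinct a b c) {M : Type*} [CommMonoid M] (f : Letter → M) :
    ∏ i, f i = f a * f b * f c := by
  rw [h.univ_eq, Finset.prod_insert (by simp [h.ab, h.ac]), Finset.prod_pair h.bc, mul_assoc]

theorem prod_erase (h : Distinct a b c) {M : Type*} [CommMonoid M] (f : Letter → M) :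
    ∏ i ∈ Finset.univ.erase a, f i = f b * f c := by
  rw [h.univ_eq, Finset.erase_insert (by simp [h.ab, h.ac]), Finset.prod_pair h.bc]

end Letter.Distinct

theorem Letter.exists_distinct (a : Letter) : ∃ b c, Letter.Distinct a b c := by
  cases a
  exacts [⟨Y, Z, by constructor <;> decide⟩, ⟨X, Z, by constructor <;> decide⟩,
    ⟨X, Y, by constructor <;> decide⟩]

theorem Letter.exists_third {a b : Letter} (h : a ≠ b) : ∃ c, Letter.Distinct a b c := by
  revert h
  cases a <;> cases b <;> intro h
  all_goals first
    | exact absurd rfl h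
    | exact ⟨.X, ⟨by decide, by decide, by decide⟩⟩
    | exact ⟨.Y, ⟨by decide, by decide, by decide⟩⟩
    | exact ⟨.Z, ⟨by decide, by decide, by decide⟩⟩

theorem Letter.sum_univ {M : Type*} [AddCommMonoid M] (f : Letter → M) :
    ∑ a, f a = f .X + f .Y + f .Z :=
  Letter.Distinct.sum_eq ⟨by decide, by decide, by decide⟩ f

/-- The relations between the three operators `h a = a ⊗ a` on one bond: for distinct letters
`(a b) ⊗ (a b) = (± i c) ⊗ (± i c) = -(c ⊗ c)`. -/
structure BondRelations {A : Type*} [Ring A] (h : Letter → A) : Prop where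
  mul_self : ∀ a, h a * h a = 1
  mul_of_distinct : ∀ {a b c}, Letter.Distinct a b c → h a * h b = -h c

theorem BondRelations.comm {A : Type*} [Ring A] {h : Letter → A} (H : BondRelations h)
    (a b : Letter) : h a * h b = h b * h a := by
  by_cases hab : a = b
  · rw [hab]
  · obtain ⟨c, hc⟩ := Letter.exists_third hab
    rw [H.mul_of_distinct hc, H.mul_of_distinct hc.swap]

/-- The operator `∑ a ≠ b, 2 J_a h_a`. If `h` belongs to a bond next to one carrying the letter `b`,
the summands are those which anticommute with that letter. -/
def crossTerm {R A : Type*} [CommRing R] [Ring A] [Algebra R A] (J : Letter → R) (h : Letter → A)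
    (b : Letter) : A :=
  ∑ a, if a = b then 0 else (2 * J a) • h a

/-! ### Weights of words and the local identities -/

/-- A point `(x, t)` of the curve `t² = x ∏ a, (1 - J_a² x)` with coordinates in a commutative ring,
together with a square root `I` of `-1` and inverses `u a` of the factors `1 - J_a² x`. -/
structure Weights (R : Type*) [CommRing R] where
  I : R
  J : Letter → R
  x : R
  t : R
  u : Letter → R
  I_sq : I * I = -1
  u_mul : ∀ a, u a * (1 - J a ^ 2 * x) = 1
  t_sq : t ^ 2 = x * ∏ a, (1 - J a ^ 2 * x)

namespace Weights

variable {R : Type*} [CommRing R] (w : Weights R)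

/-- The factors `v_a = 1 - J_a² x`. -/
def v (a : Letter) : R := 1 - w.J a ^ 2 * w.x

/-- The weight `-i t J_a / v_a` of the last letter of a block. -/
def c (a : Letter) : R := -w.I * w.t * w.J a * w.u a

/-- The weight of the letter `b` when it is followed by the letter `a`: a hole if `a = b`, the end
of a block otherwise. -/
def T (b a : Letter) : R := if b = a then w.x * ∏ d ∈ Finset.univ.erase b, w.J d else w.c b

/-- The constant part of the defect at an end of a word. -/
def kappa : R := -2 * w.I * ∏ a, w.v a

/-- The potential of two adjacent letters: up to the factor `t`, the terms of the commutator with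
`H` that change one letter of a word, with left neighbour `l` and right neighbour `r`, to `a` add up
to the multiple `G a r - G l a` of the word, hence telescope along the word. -/
def G (b a : Letter) : R := if b = a then 0 else 2 * w.I * (w.v b * w.v a)

/-- The multiple of a word starting with `b` that is gained or lost, up to the factor `t`, when a
letter is put in front of it or removed. -/
def theta (b : Letter) : R := 2 * w.t * ∑ a, if a = b then 0 else w.c a * w.J a

variable {A : Type*} [Ring A] [Algebra R A]

theorem c_mul_v (a : Letter) : w.c a * w.v a = -w.I * w.t * w.J a := by
  unfold c v
  linear_combination (-w.I * w.t * w.J a) * w.u_mul a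

theorem t_mul_c {a b c : Letter} (h : Letter.Distinct a b c) :
    w.t * w.c a = -w.I * w.x * w.J a * (w.v b * w.v c) := by
  have h1 := w.u_mul a
  have h2 := w.t_sq
  rw [h.prod_eq] at h2
  have hv : ∀ a, w.v a = 1 - w.J a ^ 2 * w.x := fun _ => rfl
  simp only [Weights.c, hv]
  linear_combination (-w.I * w.J a * w.u a) * h2 +
    (-w.I * w.J a * w.x * (1 - w.J b ^ 2 * w.x) * (1 - w.J c ^ 2 * w.x)) * h1

theorem G_self (a : Letter) : w.G a a = 0 := if_pos rfl

section Distinct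

variable {a b d : Letter} (h : Letter.Distinct a b d)

include h

theorem T_self : w.T a a = w.x * (w.J b * w.J d) := by rw [T, if_pos rfl, h.prod_erase]

theorem T_ne : w.T a b = w.c a := if_neg h.ab

theorem kappa_eq : w.kappa = -2 * w.I * (w.v a * w.v b * w.v d) := by rw [kappa, h.prod_eq]

theorem G_ne : w.G a b = 2 * w.I * (w.v a * w.v b) := if_neg h.ab

theorem theta_eq : w.theta a = 2 * w.t * (w.c b * w.J b + w.c d * w.J d) := by
  rw [theta, h.sum_eq, if_pos rfl, if_neg h.ab.symm, if_neg h.ac.symm, zero_add]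

theorem crossTerm_eq (g : Letter → A) :
    crossTerm w.J g a = (2 * w.J b) • g b + (2 * w.J d) • g d := by
  rw [crossTerm, h.sum_eq, if_pos rfl, if_neg h.ab.symm, if_neg h.ac.symm, zero_add]

end Distinct

/-- The terms of the commutator with `H` that act on the bond between given neighbours `b` and `r`,
summed over the letter on that bond. -/
theorem window_identity {h : Letter → A} (H : BondRelations h) (b r : Letter) :
    ∑ a, (w.T b a * w.T a r) • (h a * (w.t • (crossTerm w.J h b - crossTerm w.J h r) +
      algebraMap R A (w.G b a - w.G a r))) = 0 := by
  by_cases hbr : b = r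
  · subst hbr
    simp only [G, eq_comm (a := b), mul_comm (w.v b)]
    simp
  obtain ⟨d, hd⟩ := Letter.exists_third hbr
  have h1 := hd.swap
  have h2 := hd.rotate
  have h3 := h1.rotate
  have h4 := h2.rotate
  have h5 := h3.rotate
  have t3 := w.t_mul_c h4
  have c3 := w.c_mul_v d
  have v1 : w.v b = 1 - w.J b ^ 2 * w.x := rfl
  have v2 : w.v r = 1 - w.J r ^ 2 * w.x := rfl
  simp only [hd.sum_eq, w.T_self hd, w.T_self h1, w.T_ne hd, w.T_ne h3, w.T_ne h5, w.G_ne hd,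
    w.G_ne h3, w.G_ne h5, w.G_self, w.crossTerm_eq hd, w.crossTerm_eq h1,
    Algebra.algebraMap_eq_smul_one, mul_add, mul_sub, mul_smul_comm, mul_one, H.mul_self,
    H.mul_of_distinct hd, H.mul_of_distinct h1, H.mul_of_distinct h2, H.mul_of_distinct h3,
    H.mul_of_distinct h4, H.mul_of_distinct h5]
  match_scalars
  · linear_combination (2 * w.I * w.c b * (w.v b - w.v r)) * c3 -
      2 * w.t * w.J d * w.c b * (w.v b - w.v r) * w.I_sq + (2 * w.t * w.J d * w.c b) * (v1 - v2)
  · linear_combination (2 * w.J b * w.c b) * t3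
  · ring
  · linear_combination (-2 * w.J r * w.c b) * t3

/-- The recursion step at the right end of a word: the terms in which the bond after the letter `b`
carries the last letter of the word or no letter. -/
theorem tail_identity {h : Letter → A} (H : BondRelations h) (b : Letter) :
    algebraMap R A (w.theta b * w.c b) - ∑ a, (w.G b a * w.T b a * w.c a) • h a =
      (w.t * w.c b) • crossTerm w.J h b +
        ∑ a, (w.t * w.T b a * w.c a) • (h a * crossTerm w.J h b) +
        ∑ a, (w.T b a * w.c a * (2 * w.kappa + w.theta a)) • h a := by
  obtain ⟨r, d, hd⟩ := b.exists_distinct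
  have h1 := hd.swap
  have h2 := hd.rotate
  have h3 := h1.rotate
  have h4 := h2.rotate
  have h5 := h3.rotate
  have t1 := w.t_mul_c hd
  have t2 := w.t_mul_c h1
  have t3 := w.t_mul_c h4
  have c3 := w.c_mul_v d
  have c2 := w.c_mul_v r
  have v1 : w.v b = 1 - w.J b ^ 2 * w.x := rfl
  have v2 : w.v r = 1 - w.J r ^ 2 * w.x := rfl
  have v3 : w.v d = 1 - w.J d ^ 2 * w.x := rfl
  simp only [hd.sum_eq, w.T_self hd, w.T_ne hd, w.T_ne h3, w.G_ne hd, w.G_ne h3, w.G_self,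
    w.crossTerm_eq hd, w.theta_eq hd, w.theta_eq h1, w.theta_eq h4, w.kappa_eq hd,
    Algebra.algebraMap_eq_smul_one, mul_add, mul_smul_comm, H.mul_self,
    H.mul_of_distinct hd, H.mul_of_distinct h2, H.mul_of_distinct h3, H.mul_of_distinct h5]
  simp only [v1, v2, v3] at t1 t2 t3 c2 c3 ⊢
  match_scalars
  · ring
  · linear_combination (2 * w.c b * w.J r * (1 - w.J d ^ 2 * w.x)) * t3 +
      (2 * w.c b * w.J d * (1 - w.J r ^ 2 * w.x)) * t2
  · linear_combination (-2 * w.c b * w.c r * w.J d) * t3 - (2 * w.c b * w.c r * w.J b) * t1 +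
      (2 * w.I * w.c b * (1 - w.J d ^ 2 * w.x)) * c2 -
      (2 * w.c b * w.t * w.J r * (1 - w.J d ^ 2 * w.x)) * w.I_sq
  · linear_combination (-2 * w.c b * w.c d * w.J r) * t2 - (2 * w.c b * w.c d * w.J b) * t1 +
      (2 * w.I * w.c b * (1 - w.J r ^ 2 * w.x)) * c3 -
      (2 * w.c b * w.t * w.J d * (1 - w.J r ^ 2 * w.x)) * w.I_sq

/-- The left end of a word whose second letter is `r`: the letter before `r` is changed, removed or
put in front of a word starting with `r`. -/
theorem head_identity {h : Letter → A} (H : BondRelations h) (r : Letter) :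
    -w.t • crossTerm w.J h r - ∑ a, ((2 * w.kappa + w.G a r) * w.T a r) • h a -
        ∑ a, (w.t * w.T a r) • (h a * crossTerm w.J h r) =
      -algebraMap R A (w.theta r) + ∑ a, (w.T a r * w.theta a) • h a := by
  obtain ⟨b, d, hd⟩ := r.exists_distinct
  have h1 := hd.swap
  have h2 := hd.rotate
  have h3 := h1.rotate
  have h4 := h2.rotate
  have h5 := h3.rotate
  have t1 := w.t_mul_c hd
  have t2 := w.t_mul_c h1
  have t3 := w.t_mul_c h4
  have c3 := w.c_mul_v d
  have c2 := w.c_mul_v b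
  have v1 : w.v r = 1 - w.J r ^ 2 * w.x := rfl
  have v2 : w.v b = 1 - w.J b ^ 2 * w.x := rfl
  have v3 : w.v d = 1 - w.J d ^ 2 * w.x := rfl
  simp only [hd.sum_eq, w.T_self hd, w.T_ne h1, w.T_ne h4, w.G_ne h1, w.G_ne h4, w.G_self,
    w.crossTerm_eq hd, w.theta_eq hd, w.theta_eq h1, w.theta_eq h4, w.kappa_eq hd,
    Algebra.algebraMap_eq_smul_one, mul_add, mul_smul_comm, H.mul_self,
    H.mul_of_distinct hd, H.mul_of_distinct h2, H.mul_of_distinct h3, H.mul_of_distinct h5]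
  simp only [v1, v2, v3] at t1 t2 t3 c2 c3 ⊢
  match_scalars
  · linear_combination (-2 * w.c b * w.J d) * t3 - (2 * w.c b * w.J r) * t1 +
      (2 * w.I * (1 - w.J d ^ 2 * w.x)) * c2 - (2 * w.t * w.J b * (1 - w.J d ^ 2 * w.x)) * w.I_sq
  · linear_combination (-2 * w.c d * w.J b) * t2 - (2 * w.c d * w.J r) * t1 +
      (2 * w.I * (1 - w.J b ^ 2 * w.x)) * c3 - (2 * w.t * w.J d * (1 - w.J b ^ 2 * w.x)) * w.I_sq
  · linear_combination (2 * w.J b * (1 - w.J d ^ 2 * w.x)) * t3 +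
      (2 * w.J d * (1 - w.J b ^ 2 * w.x)) * t2
  · ring

theorem crossTerm_comm {h : Letter → A} (H : BondRelations h) (b a : Letter) :
    crossTerm w.J h b * h a = h a * crossTerm w.J h b := by
  unfold crossTerm
  rw [Finset.sum_mul, Finset.mul_sum]
  refine Finset.sum_congr rfl fun d _ => ?_
  split_ifs
  · simp
  · rw [smul_mul_assoc, mul_smul_comm, H.comm]

section HalfOpenWords

variable {h : Letter → A} (H : BondRelations h) (E : Letter → A)

/-- One step of the recursion for the sum of all words after the letter `a`, from the sums `E r` of
all words starting with the letter `r`. -/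
def tailStep (a : Letter) : A := algebraMap R A (w.c a) + ∑ r, w.T a r • E r

include H in
/-- `tail_identity` and `window_identity` with the remaining words attached on the right. -/
theorem tail_recursion (b : Letter) :
    algebraMap R A (w.theta b * w.c b) -
        ∑ a, (w.G b a * w.T b a) • (h a * w.tailStep E a) -
        w.t • (crossTerm w.J h b *
          (algebraMap R A (w.c b) + ∑ a, w.T b a • (h a * w.tailStep E a))) =
      ∑ a, (w.T b a * (w.c a * (2 * w.kappa + w.theta a))) • h a -
        ∑ a, ∑ r, (w.T b a * (w.G a r * w.T a r)) • (h a * E r) -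
        ∑ a, ∑ r, (w.T b a * (w.t * w.T a r)) • (h a * (crossTerm w.J h r * E r)) := by
  have e1 := w.tail_identity H b
  have e2 : ∑ r, (∑ a, (w.T b a * w.T a r) •
      (h a * (w.t • (crossTerm w.J h b - crossTerm w.J h r) +
        algebraMap R A (w.G b a - w.G a r)))) * E r = 0 := by
    simp only [w.window_identity H, zero_mul, Finset.sum_const_zero]
  simp only [Finset.sum_mul] at e2
  rw [Finset.sum_comm] at e2
  simp only [tailStep, mul_add, Finset.mul_sum, mul_smul_comm,
    ← mul_assoc (crossTerm w.J h b), w.crossTerm_comm H,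
    ← Algebra.commutes (R := R) (A := A), ← Algebra.smul_def, smul_add, Finset.smul_sum, smul_smul,
    Finset.sum_add_distrib, map_sub, mul_sub, smul_sub, Finset.sum_sub_distrib, sub_mul, add_mul,
    smul_mul_assoc, mul_assoc] at e1 e2 ⊢
  simp only [Letter.sum_univ] at e1 e2 ⊢
  linear_combination (norm := module) e1 - e2

include H in
/-- `head_identity` with the remaining words attached on the right. -/
theorem head_recursion :
    ∑ a, ((-2 * w.kappa) • (h a * w.tailStep E a) - ∑ r, (w.G a r * w.T a r) • (h a * E r) +
          (w.c a * (2 * w.kappa + w.theta a)) • h a -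
          ∑ r, (w.t * w.T a r) • (h a * (crossTerm w.J h r * E r))) -
        ∑ r, w.t • (crossTerm w.J h r * E r) =
      ∑ a, w.theta a • (h a * w.tailStep E a) - ∑ r, w.theta r • E r := by
  have e : ∑ r, (-w.t • crossTerm w.J h r - ∑ a, ((2 * w.kappa + w.G a r) * w.T a r) • h a -
       ∑ a, (w.t * w.T a r) • (h a * crossTerm w.J h r)) * E r =
      ∑ r, (-algebraMap R A (w.theta r) + ∑ a, (w.T a r * w.theta a) • h a) * E r := by
    simp only [w.head_identity H]
  simp only [tailStep, mul_add, Finset.mul_sum, mul_smul_comm,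
    ← Algebra.commutes (R := R) (A := A), ← Algebra.smul_def, smul_add, Finset.smul_sum, smul_smul,
    Finset.sum_add_distrib, Finset.sum_sub_distrib, sub_mul, add_mul,
    neg_mul, Finset.sum_mul, smul_mul_assoc, mul_assoc] at e ⊢
  simp only [Letter.sum_univ] at e ⊢
  linear_combination (norm := module) e

end HalfOpenWords

/-! ### The commutator of the generating element with the Hamiltonian -/

section Chain

variable {L : ℕ} {h : ZMod L → Letter → A} (H : ∀ i, BondRelations (h i))
  {F : ZMod L → Letter → A} (hF : ∀ i b, F i b = algebraMap R A (w.c b) +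
    ∑ a, w.T b a • (h i a * F (i + 1) a))
  {Ham : A} (hHam : ∀ i a, ⁅h i a, Ham⁆ =
    h i a * crossTerm w.J (h (i + 1)) a - crossTerm w.J (h (i - 1)) a * h i a)

variable (h F) in
/-- The closed form of `t [F i b, H]`, where `F i b` is the sum of all words on the bonds `i, i+1,
…` that can follow the letter `b` on the bond `i - 1`. The first three terms come from the right end
and the telescoping potential; the last two correct for the bonds `i` and `i - 1`, on which `H` acts
without seeing the letter `b`. -/
def tailBracket (i : ZMod L) (b : Letter) : A :=
  (-2 * w.kappa) • F i b - ∑ a, (w.G b a * w.T b a) • (h i a * F (i + 1) a) +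
    algebraMap R A (w.c b * (2 * w.kappa + w.theta b)) - w.t • (crossTerm w.J (h i) b * F i b) -
    ∑ a, (w.t * w.T b a) • (crossTerm w.J (h (i - 1)) a * (h i a * F (i + 1) a))

include hF in
theorem eq_tailStep (i : ZMod L) (b : Letter) :
    F i b = w.tailStep (fun a => h i a * F (i + 1) a) b := hF i b

/-- The value of `t [h i a * F (i + 1) a, H]` when the closed form is used for the second factor:
the terms in which `H` acts on the bond `i + 1` cancel. -/
theorem headBracket_eq (i : ZMod L) (a : Letter) :
    w.t • ((h i a * crossTerm w.J (h (i + 1)) a - crossTerm w.J (h (i - 1)) a * h i a) *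
          F (i + 1) a) +
        h i a * w.tailBracket h F (i + 1) a =
      (-2 * w.kappa) • (h i a * F (i + 1) a) -
          ∑ r, (w.G a r * w.T a r) • (h i a * (h (i + 1) r * F (i + 1 + 1) r)) +
          (w.c a * (2 * w.kappa + w.theta a)) • h i a -
          ∑ r, (w.t * w.T a r) •
            (h i a * (crossTerm w.J (h i) r * (h (i + 1) r * F (i + 1 + 1) r))) -
          w.t • (crossTerm w.J (h (i - 1)) a * (h i a * F (i + 1) a)) := by
  simp only [tailBracket, add_sub_cancel_right, mul_sub, mul_add, sub_mul, mul_smul_comm, smul_sub,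
    Finset.mul_sum, mul_assoc]
  rw [← Algebra.commutes, ← Algebra.smul_def]
  module

include H hF in
/-- The closed form satisfies the recursion that the commutator satisfies by the Leibniz rule. -/
theorem tailBracket_eq (i : ZMod L) (b : Letter) :
    w.tailBracket h F i b = ∑ a, w.T b a •
      (w.t • ((h i a * crossTerm w.J (h (i + 1)) a - crossTerm w.J (h (i - 1)) a * h i a) *
          F (i + 1) a) +
        h i a * w.tailBracket h F (i + 1) a) := by
  have e := w.tail_recursion (H i) (fun r => h (i + 1) r * F (i + 1 + 1) r) b
  simp only [← w.eq_tailStep hF] at e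
  rw [← hF] at e
  have e2 := hF i b
  simp only [headBracket_eq, smul_sub, smul_add, Finset.sum_sub_distrib, Finset.sum_add_distrib,
    Finset.smul_sum, smul_smul]
  unfold tailBracket
  rw [← sub_eq_zero] at e ⊢
  rw [show (-2 * w.kappa) • F i b = algebraMap R A (-2 * w.kappa * w.c b) +
    ∑ a, (w.T b a * (-2 * w.kappa)) • (h i a * F (i + 1) a) from ?_]
  · rw [← e]
    simp only [Algebra.algebraMap_eq_smul_one, mul_comm (w.t)]
    module
  · rw [e2, smul_add, Finset.smul_sum, Algebra.algebraMap_eq_smul_one,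
      Algebra.algebraMap_eq_smul_one, smul_smul]
    simp only [smul_smul, mul_comm]

include H hF hHam in
/-- Both sides solve the same inhomogeneous recursion, so they agree as soon as the homogeneous one
has no nonzero solution. -/
theorem tail_lie (hU : ∀ δ : ZMod L → Letter → A,
    (∀ i b, δ i b = ∑ a, w.T b a • (h i a * δ (i + 1) a)) → δ = 0) (i : ZMod L) (b : Letter) :
    w.t • ⁅F i b, Ham⁆ = w.tailBracket h F i b := by
  rw [← sub_eq_zero]
  refine congrFun (congrFun
    (hU (fun i b => w.t • ⁅F i b, Ham⁆ - w.tailBracket h F i b) ?_) i) b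
  intro i b
  have e : ⁅F i b, Ham⁆ = ∑ a, w.T b a • ⁅h i a * F (i + 1) a, Ham⁆ := by
    rw [hF]
    simp only [Ring.lie_def, add_mul, mul_add, Algebra.commutes (R := R) (A := A),
      add_sub_add_left_eq_sub, Finset.sum_mul, Finset.mul_sum, ← Finset.sum_sub_distrib,
      smul_mul_assoc, mul_smul_comm, smul_sub]
  rw [e, w.tailBracket_eq H hF, Finset.smul_sum, ← Finset.sum_sub_distrib]
  refine Finset.sum_congr rfl fun a _ => ?_
  rw [smul_comm w.t, ← smul_sub, ← hHam]
  congr 1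
  simp only [mul_sub, Ring.lie_def, mul_smul_comm, sub_mul, smul_sub, mul_assoc]
  abel

include H hF hHam in
theorem lie_sum_eq_zero [NeZero L] (hU : ∀ δ : ZMod L → Letter → A,
    (∀ i b, δ i b = ∑ a, w.T b a • (h i a * δ (i + 1) a)) → δ = 0)
    (ht : ∀ y : A, w.t • y = 0 → y = 0) :
    ⁅∑ i, ∑ a, h i a * F (i + 1) a, Ham⁆ = 0 := by
  apply ht
  have e (i : ZMod L) (a : Letter) : w.t • ⁅h i a * F (i + 1) a, Ham⁆ =
      w.t • ((h i a * crossTerm w.J (h (i + 1)) a - crossTerm w.J (h (i - 1)) a * h i a) *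
          F (i + 1) a) +
        h i a * w.tailBracket h F (i + 1) a := by
    rw [← w.tail_lie H hF hHam hU, ← hHam]
    simp only [mul_sub, Ring.lie_def, mul_smul_comm, sub_mul, smul_sub, mul_assoc]
    abel
  have shift (g : ZMod L → A) : ∑ i, g (i + 1) = ∑ i, g i :=
    Equiv.sum_comp (Equiv.addRight (1 : ZMod L)) g
  calc w.t • ⁅∑ i, ∑ a, h i a * F (i + 1) a, Ham⁆ =
        ∑ i, ∑ a, w.t • ⁅h i a * F (i + 1) a, Ham⁆ := by
        simp only [Ring.lie_def, Finset.sum_mul, Finset.mul_sum, Finset.smul_sum,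
          Finset.sum_sub_distrib, smul_sub]
    _ = ∑ i, (∑ a, ((-2 * w.kappa) • (h i a * F (i + 1) a) -
          ∑ r, (w.G a r * w.T a r) • (h i a * (h (i + 1) r * F (i + 1 + 1) r)) +
          (w.c a * (2 * w.kappa + w.theta a)) • h i a -
          ∑ r, (w.t * w.T a r) •
            (h i a * (crossTerm w.J (h i) r * (h (i + 1) r * F (i + 1 + 1) r)))) -
          ∑ a, w.t • (crossTerm w.J (h (i - 1)) a * (h i a * F (i + 1) a))) := by
        simp only [e, headBracket_eq, Finset.sum_sub_distrib]
    _ = ∑ i, (∑ a, w.theta a • (h i a * F (i + 1) a) -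
          ∑ a, w.theta a • (h (i + 1) a * F (i + 1 + 1) a)) := by
        -- Moving the last sum to the next bond puts each summand in the form of `head_recursion`.
        rw [Finset.sum_sub_distrib, ← shift (fun i =>
            ∑ a, w.t • (crossTerm w.J (h (i - 1)) a * (h i a * F (i + 1) a))),
          ← Finset.sum_sub_distrib]
        refine Finset.sum_congr rfl fun i _ => ?_
        have := w.head_recursion (H i) (fun r => h (i + 1) r * F (i + 1 + 1) r)
        simp only [← w.eq_tailStep hF] at this
        rw [← this]
        simp only [add_sub_cancel_right]
    _ = 0 := by
        rw [Finset.sum_sub_distrib, shift (fun i => ∑ a, w.theta a • (h i a * F (i + 1) a)),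
          sub_self]

end Chain

end Weights

/-! ### Linear recursions over power series -/

open PowerSeries in
/-- Solvability of a recursion that is zero modulo `X`, by Nakayama's lemma. -/
theorem exists_eq_add_X_smul {k M : Type*} [Field k] [AddCommGroup M] [Module k⟦X⟧ M]
    [Module.Finite k⟦X⟧ M] (S : M →ₗ[k⟦X⟧] M) (m₀ : M) : ∃ m, m = m₀ + (X : k⟦X⟧) • S m := by
  have key : (⊤ : Submodule k⟦X⟧ M) ≤
      LinearMap.range ((LinearMap.id : M →ₗ[k⟦X⟧] M) - (X : k⟦X⟧) • S) := by
    refine Submodule.le_of_le_smul_of_le_jacobson_bot (I := Ideal.span {X})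
      Module.Finite.fg_top ?_ fun m _ => ?_
    · rw [IsLocalRing.jacobson_eq_maximalIdeal _ bot_ne_top, PowerSeries.maximalIdeal_eq_span_X]
    · rw [show m = ((LinearMap.id : M →ₗ[k⟦X⟧] M) - (X : k⟦X⟧) • S) m + (X : k⟦X⟧) • S m by simp]
      exact Submodule.add_mem_sup ⟨m, rfl⟩
        (Submodule.smul_mem_smul (Ideal.mem_span_singleton_self _) trivial)
  obtain ⟨m, hm⟩ := key (Submodule.mem_top (x := m₀))
  refine ⟨m, ?_⟩
  rw [← hm]; simp

open PowerSeries in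
theorem eq_zero_of_eq_X_smul {k M : Type*} [Field k] [AddCommGroup M] [Module k⟦X⟧ M]
    [Module.Finite k⟦X⟧ M] (S : M →ₗ[k⟦X⟧] M) {m : M} (hm : m = (X : k⟦X⟧) • S m) : m = 0 := by
  have hs : Function.Surjective ((LinearMap.id : M →ₗ[k⟦X⟧] M) - (X : k⟦X⟧) • S) := fun m₀ => by
    obtain ⟨m, hm⟩ := exists_eq_add_X_smul S m₀
    exact ⟨m, by simpa [sub_eq_iff_eq_add] using hm⟩
  refine OrzechProperty.injective_of_surjective_endomorphism _ hs ?_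
  simpa [sub_eq_zero] using hm

theorem eq_sum_pow_add {R M : Type*} [Semiring R] [AddCommGroup M] [Module R M]
    {S : M →ₗ[R] M} {m m₀ : M} (hm : m = m₀ + S m) (N : ℕ) :
    m = ∑ n ∈ Finset.range N, (S ^ n) m₀ + (S ^ N) m := by
  induction N with
  | zero => simp
  | succ N ih =>
    nth_rewrite 1 [ih]
    nth_rewrite 1 [hm]
    rw [Finset.sum_range_succ, map_add, add_assoc, pow_succ (n := N)]
    rfl

/-! ### Words of bond operators -/

theorem isHole_cons_zero {n : ℕ} (a : Letter) (A : Fin (n + 1) → Letter) :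
    IsHole (Fin.cons a A : Fin (n + 2) → Letter) 0 ↔ a = A 0 :=
  ⟨fun ⟨_, h⟩ => h, fun h => ⟨by simp, h⟩⟩

theorem isHole_cons_succ {n : ℕ} (a : Letter) (A : Fin n → Letter) (j : Fin n) :
    IsHole (Fin.cons a A : Fin (n + 1) → Letter) j.succ ↔ IsHole A j :=
  ⟨fun ⟨h, e⟩ => ⟨Nat.lt_of_succ_lt_succ h, e⟩, fun ⟨h, e⟩ => ⟨Nat.succ_lt_succ h, e⟩⟩

theorem not_isHole_last {n : ℕ} (A : Fin (n + 1) → Letter) : ¬ IsHole A (Fin.last n) :=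
  fun ⟨h, _⟩ => by simp at h

/-- The ordered product `h_i(A_1) h_{i+1}(A_2) ⋯` along consecutive bonds. -/
def bondWord {S : Type*} [Monoid S] {L l : ℕ} (h : ZMod L → Letter → S) (i : ZMod L)
    (A : Fin l → Letter) : S :=
  (List.ofFn fun j : Fin l => h (i + ((j : ℕ) : ZMod L)) (A j)).prod

theorem bondWord_zero {S : Type*} [Monoid S] {L : ℕ} (h : ZMod L → Letter → S) (i : ZMod L)
    (A : Fin 0 → Letter) : bondWord h i A = 1 := by simp [bondWord]

theorem bondWord_cons {S : Type*} [Monoid S] {L l : ℕ} (h : ZMod L → Letter → S) (i : ZMod L)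
    (a : Letter) (A : Fin l → Letter) :
    bondWord h i (Fin.cons a A : Fin (l + 1) → Letter) = h i a * bondWord h (i + 1) A := by
  simp [bondWord, List.ofFn_succ, add_assoc, add_comm (1 : ZMod L)]

theorem map_bondWord {S S' : Type*} [Monoid S] [Monoid S'] {L l : ℕ} (φ : S →* S')
    (h : ZMod L → Letter → S) (i : ZMod L) (A : Fin l → Letter) :
    bondWord (fun i a => φ (h i a)) i A = φ (bondWord h i A) := by
  rw [bondWord, bondWord, map_list_prod, List.map_ofFn]; rfl

namespace Weights

variable {R : Type*} [CommRing R] (w : Weights R) {A : Type*} [Ring A] [Algebra R A]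

/-- The weight of a word, the product of the weights of its letters. -/
def wordWeight {l : ℕ} (B : Fin l → Letter) : R :=
  ∏ j, if IsHole B j then w.x * ∏ d ∈ Finset.univ.erase (B j), w.J d else w.c (B j)

theorem wordWeight_cons_cons {n : ℕ} (b a : Letter) (B : Fin n → Letter) :
    w.wordWeight (Fin.cons b (Fin.cons a B : Fin (n + 1) → Letter) : Fin (n + 2) → Letter) =
      w.T b a * w.wordWeight (Fin.cons a B : Fin (n + 1) → Letter) := by
  rw [wordWeight, Fin.prod_univ_succ]
  simp only [isHole_cons_zero, isHole_cons_succ, Fin.cons_zero, Fin.cons_succ]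
  rfl

theorem wordWeight_singleton (b : Letter) (B : Fin 0 → Letter) :
    w.wordWeight (Fin.cons b B : Fin 1 → Letter) = w.c b := by
  rw [wordWeight, Fin.prod_univ_one, if_neg fun h => by simpa using h.1, Fin.cons_zero]

variable {L : ℕ} (h : ZMod L → Letter → A)

/-- The linear map that puts one more letter in front of families `F i b` of words starting at the
bond `i` after the letter `b`, with weights `T`. -/
def step (T : Letter → Letter → R) (h : ZMod L → Letter → A) :
    (ZMod L → Letter → A) →ₗ[R] (ZMod L → Letter → A) where
  toFun F i b := ∑ a, T b a • (h i a * F (i + 1) a)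
  map_add' F F' := by ext i b; simp [mul_add, Finset.sum_add_distrib]
  map_smul' r F := by ext i b; simp [Finset.smul_sum, smul_comm r]

theorem step_smul (z : R) (T : Letter → Letter → R) (h : ZMod L → Letter → A) :
    step (fun b a => z * T b a) h = z • step T h := by
  ext F i b
  simp [step, mul_smul, Finset.smul_sum]

theorem sum_fin_succ_arrow {n : ℕ} {M : Type*} [AddCommMonoid M]
    (g : (Fin (n + 1) → Letter) → M) :
    ∑ B, g B = ∑ a, ∑ B : Fin n → Letter, g (Fin.cons a B) := by
  rw [← Fintype.sum_prod_type', ← (Fin.consEquiv fun _ => Letter).sum_comp]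
  rfl

theorem step_pow_apply (n : ℕ) (i : ZMod L) (b : Letter) :
    (step w.T h ^ n) (fun _ b => algebraMap R A (w.c b)) i b = ∑ B : Fin n → Letter,
      w.wordWeight (Fin.cons b B : Fin (n + 1) → Letter) • bondWord h i B := by
  induction n generalizing i b with
  | zero => simp [wordWeight_singleton, bondWord_zero, Algebra.algebraMap_eq_smul_one]
  | succ n ih =>
    rw [pow_succ', Module.End.mul_apply]
    change ∑ a, w.T b a • (h i a * _) = _
    rw [sum_fin_succ_arrow]
    refine Finset.sum_congr rfl fun a _ => ?_
    rw [ih, Finset.mul_sum, Finset.smul_sum]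
    refine Finset.sum_congr rfl fun B _ => ?_
    rw [bondWord_cons, wordWeight_cons_cons, mul_smul, mul_smul_comm]

theorem sum_mul_step_pow (n : ℕ) (i : ZMod L) :
    ∑ a, h i a * (step w.T h ^ n) (fun _ b => algebraMap R A (w.c b)) (i + 1) a =
      ∑ B : Fin (n + 1) → Letter, w.wordWeight B • bondWord h i B := by
  rw [sum_fin_succ_arrow]
  refine Finset.sum_congr rfl fun a _ => ?_
  rw [step_pow_apply, Finset.mul_sum]
  refine Finset.sum_congr rfl fun B _ => ?_
  rw [bondWord_cons, mul_smul_comm]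

end Weights

/-! ### Pauli matrices and bond operators on the periodic chain -/

section BondOperators

variable {L : ℕ} [NeZero L]

theorem siteOp_mul_apply (i : ZMod L) (M : Matrix (Fin 2) (Fin 2) ℂ) (B : Op L)
    (s t : ZMod L → Fin 2) :
    (siteOp i M * B) s t = ∑ x, M (s i) x * B (Function.update s i x) t := by
  rw [Matrix.mul_apply]
  refine (Fintype.sum_of_injective (Function.update s i) (Function.update_injective s i) _ _
    (fun u hu => ?_) fun x => ?_).symm
  · rw [siteOp, Matrix.of_apply, if_neg, zero_mul]
    exact fun hs => hu ⟨u i, by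
      funext j
      by_cases hj : j = i
      · subst hj; simp
      · simp [hj, hs j hj]⟩
  · rw [siteOp, Matrix.of_apply, if_pos, Function.update_self]
    intro j hj
    rw [Function.update_of_ne hj]

theorem siteOp_mul (i : ZMod L) (M N : Matrix (Fin 2) (Fin 2) ℂ) :
    siteOp i M * siteOp i N = siteOp i (M * N) := by
  ext s t
  rw [siteOp_mul_apply]
  simp only [siteOp, Matrix.of_apply, Function.update_self]
  have e (x : Fin 2) : (∀ j, j ≠ i → Function.update s i x j = t j) ↔ ∀ j, j ≠ i → s j = t j :=
    forall₂_congr fun j hj => by rw [Function.update_of_ne hj]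
  simp only [e]
  split_ifs
  · rw [Matrix.mul_apply]
  · simp

theorem siteOp_one (i : ZMod L) : siteOp i (1 : Matrix (Fin 2) (Fin 2) ℂ) = 1 := by
  ext s t
  simp only [siteOp, Matrix.of_apply, Matrix.one_apply]
  by_cases hst : s = t
  · subst hst; simp
  · rw [if_neg hst]
    split_ifs with h1 h2
    · exact absurd (funext fun j => if hj : j = i then hj ▸ h2 else h1 j hj) hst
    all_goals rfl

theorem siteOp_smul (i : ZMod L) (z : ℂ) (M : Matrix (Fin 2) (Fin 2) ℂ) :
    siteOp i (z • M) = z • siteOp i M := by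
  ext s t
  simp [siteOp]

theorem siteOp_mul_siteOp_apply {i j : ZMod L} (hij : i ≠ j) (M N : Matrix (Fin 2) (Fin 2) ℂ)
    (s t : ZMod L → Fin 2) : (siteOp i M * siteOp j N) s t =
      ∑ x, ∑ y, M (s i) x * (N (s j) y *
        (1 : Op L) (Function.update (Function.update s i x) j y) t) := by
  rw [siteOp_mul_apply]
  refine Finset.sum_congr rfl fun x _ => ?_
  rw [← mul_one (siteOp j N), siteOp_mul_apply, Function.update_of_ne hij.symm, Finset.mul_sum]

theorem siteOp_comm {i j : ZMod L} (hij : i ≠ j) (M N : Matrix (Fin 2) (Fin 2) ℂ) :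
    siteOp i M * siteOp j N = siteOp j N * siteOp i M := by
  ext s t
  rw [siteOp_mul_siteOp_apply hij, siteOp_mul_siteOp_apply hij.symm, Finset.sum_comm]
  refine Finset.sum_congr rfl fun y _ => Finset.sum_congr rfl fun x _ => ?_
  rw [Function.update_comm hij, mul_left_comm]

/-- The sign with which the Pauli matrices of two letters commute. -/
def sign (a b : Letter) : ℂ := if a = b then 1 else -1

theorem pauli_mul_self (a : Letter) : pauli a * pauli a = 1 := by
  cases a <;> ext i j <;> fin_cases i <;> fin_cases j <;> simp [pauli]

theorem pauli_mul_comm (a b : Letter) : pauli a * pauli b = sign a b • (pauli b * pauli a) := by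
  cases a <;> cases b <;> ext i j <;> fin_cases i <;> fin_cases j <;> simp [pauli, sign]

theorem pauli_mul_of_distinct {a b c : Letter} (h : Letter.Distinct a b c) :
    ∃ z : ℂ, z * z = -1 ∧ pauli a * pauli b = z • pauli c := by
  obtain ⟨h1, h2, h3⟩ := h
  cases a <;> cases b <;> cases c <;>
    simp only [ne_eq, not_true_eq_false, reduceCtorEq, not_false_eq_true] at h1 h2 h3
  all_goals first
    | (refine ⟨Complex.I, Complex.I_mul_I, ?_⟩
       ext i j
       fin_cases i <;> fin_cases j <;> simp [pauli]
       done)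
    | (refine ⟨-Complex.I, by simp, ?_⟩
       ext i j
       fin_cases i <;> fin_cases j <;> simp [pauli])

/-- The coupling operator `a ⊗ a` on the bond between the sites `i` and `i + 1`. -/
def bondOp (i : ZMod L) (a : Letter) : Op L := siteOp i (pauli a) * siteOp (i + 1) (pauli a)

theorem hamiltonian_eq (J : Letter → ℂ) :
    hamiltonian L J = ∑ i : ZMod L, ∑ a, J a • bondOp i a := rfl

theorem bondRelations (hL : L ≠ 1) (i : ZMod L) : BondRelations (bondOp i) := by
  have hi : i ≠ i + 1 := by
    have : Nontrivial (ZMod L) := ZMod.nontrivial_iff.2 hL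
    simp
  have e (a b : Letter) : bondOp i a * bondOp i b =
      siteOp i (pauli a * pauli b) * siteOp (i + 1) (pauli a * pauli b) := by
    rw [bondOp, bondOp, mul_assoc, ← mul_assoc (siteOp (i + 1) _), siteOp_comm hi.symm, mul_assoc,
      siteOp_mul, ← mul_assoc, siteOp_mul]
  refine ⟨fun a => ?_, fun {a b c} h => ?_⟩
  · rw [e, pauli_mul_self, siteOp_one, siteOp_one, one_mul]
  · obtain ⟨z, hz, hab⟩ := pauli_mul_of_distinct h
    rw [e, hab, siteOp_smul, siteOp_smul, smul_mul_smul_comm, hz, neg_one_smul, bondOp]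

theorem siteOp_pauli_comm (i j : ZMod L) (a b : Letter) :
    siteOp i (pauli a) * siteOp j (pauli b) =
      (if i = j then sign a b else 1) • (siteOp j (pauli b) * siteOp i (pauli a)) := by
  split_ifs with hij
  · subst hij
    rw [siteOp_mul, siteOp_mul, ← siteOp_smul, ← pauli_mul_comm]
  · rw [one_smul, siteOp_comm hij]

theorem bondOp_mul_comm (i j : ZMod L) (a b : Letter) : bondOp i a * bondOp j b =
    ((if i = j then sign a b else 1) * (if i = j + 1 then sign a b else 1) *
      ((if i + 1 = j then sign a b else 1) * (if i + 1 = j + 1 then sign a b else 1))) •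
      (bondOp j b * bondOp i a) := by
  simp only [bondOp]
  rw [mul_assoc, ← mul_assoc (siteOp (i + 1) _), siteOp_pauli_comm (i + 1) j, smul_mul_assoc,
    mul_assoc, siteOp_pauli_comm (i + 1) (j + 1), mul_smul_comm, mul_smul_comm, mul_smul_comm,
    ← mul_assoc, ← mul_assoc, siteOp_pauli_comm i j, smul_mul_assoc, smul_mul_assoc,
    mul_assoc (siteOp j _), siteOp_pauli_comm i (j + 1), mul_smul_comm, smul_mul_assoc]
  simp only [smul_smul, mul_assoc]
  congr 1
  ring

theorem sign_mul_self (a b : Letter) : sign a b * sign a b = 1 := by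
  unfold sign; split_ifs <;> simp

theorem sign_comm (a b : Letter) : sign a b = sign b a := by
  simp only [sign, eq_comm]

/-- Only the two neighbouring bonds contribute. If `L = 2` these two bonds coincide and all bond
operators commute, so that both sides vanish. -/
theorem bondOp_lie_hamiltonian (hL : L ≠ 1) (J : Letter → ℂ) (i : ZMod L) (a : Letter) :
    ⁅bondOp i a, hamiltonian L J⁆ =
      bondOp i a * crossTerm J (bondOp (i + 1)) a -
        crossTerm J (bondOp (i - 1)) a * bondOp i a := by
  have lie_eq (s : ZMod L) : ⁅bondOp i a, ∑ b, J b • bondOp s b⁆ =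
      ∑ b, J b • (bondOp i a * bondOp s b - bondOp s b * bondOp i a) := by
    simp only [Ring.lie_def, Finset.mul_sum, Finset.sum_mul, mul_smul_comm, smul_mul_assoc,
      smul_sub, Finset.sum_sub_distrib]
  have : Nontrivial (ZMod L) := ZMod.nontrivial_iff.2 hL
  have lie_sum : ⁅bondOp i a, hamiltonian L J⁆ =
      ∑ s : ZMod L, ⁅bondOp i a, ∑ b, J b • bondOp s b⁆ := by
    rw [hamiltonian_eq]
    simp only [Ring.lie_def, Finset.mul_sum, Finset.sum_mul, Finset.sum_sub_distrib]
  rw [lie_sum]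
  by_cases h2 : (2 : ZMod L) = 0
  · have hcomm (j : ZMod L) (b : Letter) : bondOp i a * bondOp j b = bondOp j b * bondOp i a := by
      have hL2 : L = 2 := by
        have : ((2 : ℕ) : ZMod L) = 0 := by exact_mod_cast h2
        exact ((Nat.dvd_prime Nat.prime_two).1
          ((ZMod.natCast_eq_zero_iff 2 L).1 this)).resolve_left hL
      have hij : i = j ∨ i = j + 1 := by
        clear * - hL2
        subst hL2
        revert i j
        decide
      have n1 (j : ZMod L) : j ≠ j + 1 := by simp
      rw [bondOp_mul_comm]
      rcases hij with rfl | rfl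
      · simp [sign_mul_self]
      · rw [if_neg (n1 j).symm, if_pos rfl, if_pos (by linear_combination h2),
          if_neg (n1 (j + 1)).symm, one_mul, mul_one, sign_mul_self, one_smul]
    rw [Finset.sum_eq_zero, show i - 1 = i + 1 by linear_combination -h2, eq_comm, sub_eq_zero]
    · rw [crossTerm, Finset.sum_mul, Finset.mul_sum]
      refine Finset.sum_congr rfl fun b _ => ?_
      split_ifs
      · simp
      · rw [mul_smul_comm, smul_mul_assoc, hcomm]
    · intro j _
      simp [lie_eq, hcomm]
  · have n1 (j : ZMod L) : j ≠ j + 1 := by simp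
    have n2 : i + 1 ≠ i - 1 := fun h => h2 (by linear_combination h)
    rw [Fintype.sum_eq_add (i + 1) (i - 1) n2]
    · refine (congrArg₂ (· + ·) ?_ ?_).trans (sub_eq_add_neg _ _).symm
      · rw [lie_eq, crossTerm, Finset.mul_sum]
        refine Finset.sum_congr rfl fun b _ => ?_
        have n3 : i + 1 + 1 ≠ i := fun h => h2 (by linear_combination h)
        rw [bondOp_mul_comm (i + 1) i b a, if_neg (n1 i).symm, if_pos rfl, if_neg n3,
          if_neg (n1 (i + 1)).symm, sign]
        split_ifs
        · simp
        · rw [mul_smul_comm]; module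
      · rw [lie_eq, crossTerm, Finset.sum_mul, ← Finset.sum_neg_distrib]
        refine Finset.sum_congr rfl fun b _ => ?_
        have n4 : i = i - 1 + 1 := by ring
        have n3 : i ≠ i - 1 := fun h => one_ne_zero (α := ZMod L) (by linear_combination h)
        rw [bondOp_mul_comm i (i - 1) a b, if_neg n3, if_pos n4, if_neg n2, ← n4,
          if_neg (n1 i).symm, sign_comm, sign]
        split_ifs
        · simp
        · rw [smul_mul_assoc]; module
    · rintro j ⟨h1, h2⟩
      rw [lie_eq]
      refine Finset.sum_eq_zero fun b _ => ?_
      rw [bondOp_mul_comm i j a b, if_neg (c := i = j + 1) (fun h => h2 (by rw [h]; ring)),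
        if_neg (Ne.symm h1)]
      by_cases h3 : i = j
      · simp [h3, sign_mul_self]
      · simp [h3]

/-- For `L = 1` every bond operator is `a * a = 1`, hence the Hamiltonian is a scalar. -/
theorem lie_hamiltonian_one (J : Letter → ℂ) (Q : Op 1) : ⁅Q, hamiltonian 1 J⁆ = 0 := by
  have e (i : ZMod 1) (a : Letter) : bondOp i a = 1 := by
    rw [bondOp, Subsingleton.elim (i + 1) i, siteOp_mul, pauli_mul_self, siteOp_one]
  simp [hamiltonian_eq, e, Ring.lie_def, Finset.mul_sum, Finset.sum_mul]

/-- Regrouping a product of operators `p_j p_{j+1}` on consecutive sites into one operator per bond.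
The order of the factors does not change, so the sites may repeat. -/
theorem prod_siteOp_mul (p : ℕ → Matrix (Fin 2) (Fin 2) ℂ) (l : ℕ) (i : ZMod L) :
    (List.ofFn fun j : Fin (l + 1) =>
        siteOp (i + ((j : ℕ) : ZMod L)) (p (j : ℕ) * p ((j : ℕ) + 1))).prod =
      siteOp i (p 0) * (List.ofFn fun j : Fin l => siteOp (i + ((j : ℕ) : ZMod L)) (p (j + 1)) *
        siteOp (i + ((j : ℕ) : ZMod L) + 1) (p (j + 1))).prod *
        siteOp (i + (l : ZMod L)) (p (l + 1)) := by
  induction l generalizing p i with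
  | zero => simp [siteOp_mul]
  | succ l ih =>
    have := ih (fun n => p (n + 1)) (i + 1)
    rw [List.ofFn_succ, List.prod_cons]
    conv_rhs => rw [List.ofFn_succ, List.prod_cons]
    have e (n : ℕ) : i + ((n + 1 : ℕ) : ZMod L) = i + 1 + n := by push_cast; ring
    simp only [Fin.val_zero, Fin.val_succ, Nat.cast_zero, add_zero, zero_add, e] at this ⊢
    rw [this, ← siteOp_mul]
    simp only [mul_assoc]

theorem doublingAt_eq {l : ℕ} (A : Fin l → Letter) (i : ZMod L) :
    doublingAt A i = bondWord bondOp i A := by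
  rw [doublingAt, prod_siteOp_mul, padded, dif_neg (by simp), padded, dif_neg (by simp),
    siteOp_one, siteOp_one, one_mul, mul_one, bondWord]
  congr 2
  ext1 j
  rw [padded, dif_pos ⟨by omega, by omega⟩]
  rfl

theorem doubling_eq {l : ℕ} (A : Fin l → Letter) :
    doubling L A = ∑ i, bondWord bondOp i A := by
  simp only [doubling, doublingAt_eq]

end BondOperators

/-! ### The power series behind `S_n` and `R_n` -/

section Series

open PowerSeries

variable (J : Letter → ℂ)

/-- The series `1 - J_a² X`. -/
def vSeries (a : Letter) : ℂ⟦X⟧ := 1 - C (J a ^ 2) * X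

/-- The inverse of `1 - J_a² X`. -/
def uSeries (a : Letter) : ℂ⟦X⟧ := (vSeries J a)⁻¹

/-- The square root of `∏ a, (1 - J_a² X)` with constant term `1`, from the binomial series. -/
def qSeries : ℂ⟦X⟧ := ∏ a, rescale (-(J a) ^ 2) (PowerSeries.binomialSeries ℂ (1 / 2 : ℚ))

theorem constantCoeff_vSeries (a : Letter) : constantCoeff (vSeries J a) = 1 := by
  simp [vSeries]

theorem uSeries_mul_vSeries (a : Letter) : uSeries J a * vSeries J a = 1 :=
  PowerSeries.inv_mul_cancel _ (by rw [constantCoeff_vSeries]; exact one_ne_zero)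

theorem qSeries_sq : qSeries J ^ 2 = ∏ a, vSeries J a := by
  rw [qSeries, ← Finset.prod_pow]
  refine Finset.prod_congr rfl fun a _ => ?_
  rw [← map_pow, sq (PowerSeries.binomialSeries _ _), ← PowerSeries.binomialSeries_add,
    show (1 / 2 + 1 / 2 : ℚ) = ((1 : ℕ) : ℚ) by norm_num, binomialSeries_nat, pow_one, map_add,
    map_one, rescale_X, vSeries, map_neg, neg_mul, sub_eq_add_neg]

theorem qSeries_mul_inv : qSeries J * (qSeries J)⁻¹ = 1 :=
  PowerSeries.mul_inv_cancel _ (by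
    rw [qSeries, map_prod]
    simp [← coeff_zero_eq_constantCoeff_apply, coeff_rescale])

theorem coeff_uSeries_pow (a : Letter) (N n : ℕ) :
    coeff n (uSeries J a ^ N) = (Nat.multichoose N n : ℂ) * (J a ^ 2) ^ n := by
  have key (N : ℕ) :
      (PowerSeries.mk fun n => (Nat.multichoose (N + 1) n : ℂ) * (J a ^ 2) ^ n) * vSeries J a =
      PowerSeries.mk fun n => (Nat.multichoose N n : ℂ) * (J a ^ 2) ^ n := by
    ext n
    rw [vSeries, mul_sub, mul_one, ← mul_assoc, map_sub]
    cases n with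
    | zero => simp
    | succ n =>
      rw [coeff_succ_mul_X, coeff_mul_C, coeff_mk, coeff_mk, coeff_mk, Nat.multichoose_succ_succ]
      push_cast
      ring
  suffices h : uSeries J a ^ N =
      PowerSeries.mk fun n => (Nat.multichoose N n : ℂ) * (J a ^ 2) ^ n by
    rw [h, coeff_mk]
  induction N with
  | zero =>
    ext n
    cases n <;> simp [coeff_one]
  | succ N ih =>
    rw [pow_succ, ih, ← key, mul_assoc, mul_comm (vSeries J a), uSeries_mul_vSeries, mul_one]

theorem coeff_prod_uSeries (n : ℕ) (N : Letter → ℕ) :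
    coeff n (∏ a, uSeries J a ^ N a) = sFunc J n N := by
  rw [coeff_prod, sFunc]
  refine Finset.sum_bij (fun l _ => ⇑l) ?_ ?_ ?_ ?_
  · intro l hl
    simpa using hl
  · intro l _ l' _ h
    exact DFunLike.coe_injective h
  · intro p hp
    exact ⟨Finsupp.equivFunOnFinite.symm p, by simpa using hp, rfl⟩
  · intro l _
    simp only [coeff_uSeries_pow]

theorem coeff_prod_uSeries_mul (n : ℕ) (N : Letter → ℕ) :
    coeff n ((∏ a, uSeries J a ^ (N a + n)) * (4 - ∑ a, uSeries J a)) = rFunc J n N := by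
  have e (a : Letter) : (∏ b, uSeries J b ^ (N b + n)) * uSeries J a =
      ∏ b, uSeries J b ^ (N b + n + if b = a then 1 else 0) := by
    simp only [pow_add _ (_ + _ : ℕ), Finset.prod_mul_distrib]
    simp
  rw [mul_sub, mul_comm _ (4 : ℂ⟦X⟧), Finset.mul_sum, map_sub, map_sum, rFunc, ← coeff_prod_uSeries]
  simp only [e, coeff_prod_uSeries]
  congr 1
  rw [show (4 : ℂ⟦X⟧) = C (4 : ℂ) from (map_ofNat C 4).symm, coeff_C_mul, coeff_prod_uSeries]

/-- The substitution `X ↦ X ^ 2`. -/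
def substSq : ℂ⟦X⟧ →ₐ[ℂ] ℂ⟦X⟧ := expand 2 two_ne_zero

theorem substSq_X : substSq X = X ^ 2 := expand_X _ _

theorem substSq_C (z : ℂ) : substSq (C z) = C z := expand_C _ _ z

theorem coeff_two_mul_substSq (f : ℂ⟦X⟧) (n : ℕ) : coeff (2 * n) (substSq f) = coeff n f :=
  coeff_expand_mul _ _ _ _

theorem coeff_substSq_of_odd (f : ℂ⟦X⟧) {n : ℕ} (hn : ¬ 2 ∣ n) : coeff n (substSq f) = 0 :=
  coeff_expand_of_not_dvd _ _ _ hn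

theorem substSq_vSeries (a : Letter) : substSq (vSeries J a) = 1 - C (J a) ^ 2 * X ^ 2 := by
  rw [vSeries, map_sub, map_one, map_mul, substSq_X, substSq_C, map_pow]

/-- The weights over `ℂ⟦z⟧`: the point `x = z²`, `t = z (v_X v_Y v_Z)^(1/2)` of the curve. -/
def weights : Weights ℂ⟦X⟧ where
  I := C Complex.I
  J a := C (J a)
  x := X ^ 2
  t := X * substSq (qSeries J)
  u a := substSq (uSeries J a)
  I_sq := by rw [← map_mul, Complex.I_mul_I, map_neg, map_one]
  u_mul a := by
    rw [← substSq_vSeries, ← map_mul, uSeries_mul_vSeries, map_one]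
  t_sq := by
    simp only [← substSq_vSeries, ← map_prod, mul_pow, ← qSeries_sq, map_pow]

/-- The functional that takes the generating series to its `N`-th charge: the coefficient of `z^N`
after multiplication by `q^(-N) (4 - ∑ a, u_a)`, where `q = t / z`. The factor `4 - ∑ a, u_a` is the
logarithmic derivative of `t²` with respect to `x`, times `x`, so that up to its normalization this
is the coefficient of `t^N` expressed as a residue in `z`. -/
def extract (N : ℕ) : ℂ⟦X⟧ →ₗ[ℂ] ℂ :=
  (coeff (R := ℂ) N).comp (LinearMap.mulRight ℂ
    (substSq ((qSeries J)⁻¹ ^ N * (4 - ∑ a, uSeries J a))))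

theorem extract_eq_zero (N n : ℕ) (hn : N < n) (f : ℂ⟦X⟧) : extract J N (X ^ n * f) = 0 := by
  simp only [extract, LinearMap.comp_apply, LinearMap.mulRight_apply, mul_assoc]
  rw [coeff_X_pow_mul', if_neg (by omega)]

theorem numHoles_add_numBlocks {l : ℕ} (A : Fin l → Letter) : numHoles A + numBlocks A = l := by
  rw [numHoles, numBlocks, Finset.card_filter_add_card_filter_not, Finset.card_univ,
    Fintype.card_fin]

theorem prod_blocks {l : ℕ} {M : Type*} [CommMonoid M] (A : Fin l → Letter) (g : Letter → M) :
    (∏ j, if IsHole A j then 1 else g (A j)) = ∏ a, g a ^ blockCount A a := by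
  simp only [← ite_not (IsHole A _), ← Finset.prod_filter, blockCount]
  rw [← Finset.prod_fiberwise _ A]
  refine Finset.prod_congr rfl fun a _ => ?_
  rw [Finset.prod_congr rfl (g := fun _ => g a) fun j hj => by rw [(Finset.mem_filter.1 hj).2],
    Finset.prod_const, Finset.filter_filter]

theorem prod_blocks_const {l : ℕ} {M : Type*} [CommMonoid M] (A : Fin l → Letter) (g : M) :
    (∏ j, if IsHole A j then 1 else g) = g ^ numBlocks A := by
  simp only [← ite_not (IsHole A _), ← Finset.prod_filter, Finset.prod_const, numBlocks]

theorem prod_holes_const {l : ℕ} {M : Type*} [CommMonoid M] (A : Fin l → Letter) (g : M) :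
    (∏ j, if IsHole A j then g else 1) = g ^ numHoles A := by
  rw [← Finset.prod_filter, Finset.prod_const, numHoles]

theorem wordWeight_weights {l : ℕ} (A : Fin l → Letter) :
    (weights J).wordWeight A = C (coupling J A * (-Complex.I) ^ numBlocks A) *
      (X ^ (l + numHoles A) *
        substSq (qSeries J ^ numBlocks A * ∏ a, uSeries J a ^ blockCount A a)) := by
  have e (j : Fin l) : (if IsHole A j then
        (weights J).x * ∏ d ∈ Finset.univ.erase (A j), (weights J).J d else (weights J).c (A j)) =
      C (if IsHole A j then ∏ b ∈ Finset.univ.erase (A j), J b else J (A j)) *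
        C (if IsHole A j then 1 else -Complex.I) * (X * if IsHole A j then X else 1) *
        substSq ((if IsHole A j then 1 else qSeries J) *
          if IsHole A j then 1 else uSeries J (A j)) := by
    split_ifs
    · simp only [weights, map_prod, map_one, mul_one]
      ring
    · simp only [weights, Weights.c, map_mul, map_neg]
      ring
  rw [Weights.wordWeight, Finset.prod_congr rfl fun j _ => e j]
  simp only [Finset.prod_mul_distrib, ← map_prod, prod_blocks_const, prod_blocks, prod_holes_const]
  rw [Finset.prod_const, Finset.card_univ, Fintype.card_fin, pow_add, coupling]
  simp only [map_mul, mul_assoc]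

theorem inv_qSeries_sq : (qSeries J)⁻¹ ^ 2 = ∏ a, uSeries J a := by
  have h : (∏ a, uSeries J a) * qSeries J ^ 2 = 1 := by
    rw [qSeries_sq, ← Finset.prod_mul_distrib]
    simp only [uSeries_mul_vSeries, Finset.prod_const_one]
  have h' := qSeries_mul_inv J
  linear_combination (-(qSeries J)⁻¹ ^ 2) * h +
    (∏ a, uSeries J a) * (qSeries J * (qSeries J)⁻¹ + 1) * h'

theorem qSeries_pow_mul_inv_pow (b n : ℕ) :
    qSeries J ^ b * (qSeries J)⁻¹ ^ (b + 2 * n) = (∏ a, uSeries J a) ^ n := by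
  rw [pow_add, ← mul_assoc, ← mul_pow, qSeries_mul_inv, one_pow, one_mul, pow_mul, inv_qSeries_sq]

/-- The power of `q` in the weight of a word combines with `q^(-N)` to a power of `∏ a, u_a`, which
supplies the shift of the arguments of `R_n` by `n` and by the number of holes. -/
theorem extract_wordWeight_of_eq {l : ℕ} (A : Fin l → Letter) (n : ℕ) :
    extract J (l + numHoles A + 2 * n) ((weights J).wordWeight A) =
      rFunc J n (fun a => blockCount A a + numHoles A) * coupling J A *
        (-Complex.I) ^ numBlocks A := by
  rw [extract, LinearMap.comp_apply, LinearMap.mulRight_apply, wordWeight_weights, mul_assoc,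
    mul_assoc, ← map_mul, coeff_C_mul, add_comm _ (2 * n), coeff_X_pow_mul, coeff_two_mul_substSq,
    ← coeff_prod_uSeries_mul]
  have e : 2 * n + (l + numHoles A) = numBlocks A + 2 * (numHoles A + n) := by
    have := numHoles_add_numBlocks A
    omega
  rw [e]
  have e2 : ∏ a, uSeries J a ^ (blockCount A a + numHoles A + n) =
      (∏ a, uSeries J a ^ blockCount A a) * (∏ a, uSeries J a) ^ (numHoles A + n) := by
    simp only [add_assoc, pow_add _ (blockCount A _), Finset.prod_mul_distrib, Finset.prod_pow]
  rw [e2, ← qSeries_pow_mul_inv_pow, mul_assoc (coeff n _), mul_comm (coeff n _)]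
  refine congrArg (_ * ·) (congrArg (coeff n) ?_)
  ring

theorem extract_wordWeight (N : ℕ) {l : ℕ} (A : Fin l → Letter) :
    extract J N ((weights J).wordWeight A) = ∑ n ∈ Finset.range (N + 1),
      if l + numHoles A + 2 * n = N then
        rFunc J n (fun a => blockCount A a + numHoles A) * coupling J A *
          (-Complex.I) ^ numBlocks A
      else 0 := by
  by_cases hN : ∃ n, l + numHoles A + 2 * n = N
  · obtain ⟨n, rfl⟩ := hN
    rw [extract_wordWeight_of_eq, Finset.sum_eq_single n, if_pos rfl]
    · intro n' _ hn'
      rw [if_neg (by omega)]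
    · intro hn
      exact absurd (Finset.mem_range.2 (by omega)) hn
  · rw [Finset.sum_eq_zero fun n _ => if_neg fun h => hN ⟨n, h⟩, extract, LinearMap.comp_apply,
      LinearMap.mulRight_apply, wordWeight_weights, mul_assoc, mul_assoc, ← map_mul, coeff_C_mul,
      coeff_X_pow_mul']
    split_ifs with h
    · rw [coeff_substSq_of_odd, mul_zero]
      rintro ⟨n, hn⟩
      exact hN ⟨n, by omega⟩
    · rw [mul_zero]

end Series

/-! ### The generating series of the charges -/

section Generating

open PowerSeries

theorem weights_T_dvd (J : Letter → ℂ) : ∃ T : Letter → Letter → ℂ⟦X⟧,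
    (weights J).T = fun b a => X * T b a := by
  have h (b a : Letter) : ∃ y, (weights J).T b a = X * y := by
    unfold Weights.T
    split_ifs
    · exact ⟨X * ∏ d ∈ Finset.univ.erase b, C (J d), by simp only [weights]; ring⟩
    · exact ⟨-C Complex.I * substSq (qSeries J) * C (J b) * substSq (uSeries J b), by
        simp only [Weights.c, weights]; ring⟩
  choose T hT using h
  exact ⟨T, funext₂ hT⟩

theorem weights_t_ne_zero (J : Letter → ℂ) : (weights J).t ≠ 0 := by
  have h := congrArg substSq (qSeries_mul_inv J)
  rw [map_mul, map_one] at h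
  exact mul_ne_zero X_ne_zero (left_ne_zero_of_mul_eq_one h)

variable {L : ℕ} [NeZero L]

/-- Operators whose matrix entries are power series. -/
abbrev SeriesOp (L : ℕ) : Type := Matrix (ZMod L → Fin 2) (ZMod L → Fin 2) ℂ⟦X⟧

/-- Complex operators as operators with constant entries. -/
def constOp : Op L →+* SeriesOp L := (C : ℂ →+* ℂ⟦X⟧).mapMatrix

theorem constOp_smul (z : ℂ) (M : Op L) : constOp (z • M) = C z • constOp M := by
  ext1 s t
  simp [constOp]

/-- A linear functional on power series, applied to all entries. -/
def coeffOp (ρ : ℂ⟦X⟧ →ₗ[ℂ] ℂ) : SeriesOp L →+ Op L := ρ.toAddMonoidHom.mapMatrix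

theorem linearMap_mul_C (ρ : ℂ⟦X⟧ →ₗ[ℂ] ℂ) (f : ℂ⟦X⟧) (z : ℂ) : ρ (f * C z) = ρ f * z := by
  rw [mul_comm, ← smul_eq_C_mul, map_smul, smul_eq_mul, mul_comm]

theorem coeffOp_mul_constOp (ρ : ℂ⟦X⟧ →ₗ[ℂ] ℂ) (M : SeriesOp L) (B : Op L) :
    coeffOp ρ (M * constOp B) = coeffOp ρ M * B := by
  ext s t
  simp [coeffOp, constOp, Matrix.mul_apply, linearMap_mul_C]

theorem coeffOp_constOp_mul (ρ : ℂ⟦X⟧ →ₗ[ℂ] ℂ) (M : SeriesOp L) (B : Op L) :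
    coeffOp ρ (constOp B * M) = B * coeffOp ρ M := by
  ext s t
  simp [coeffOp, constOp, Matrix.mul_apply, mul_comm (C _), linearMap_mul_C, mul_comm (B _ _)]

theorem coeffOp_smul_constOp (ρ : ℂ⟦X⟧ →ₗ[ℂ] ℂ) (f : ℂ⟦X⟧) (B : Op L) :
    coeffOp ρ (f • constOp B) = ρ f • B := by
  ext s t
  simp [coeffOp, constOp, linearMap_mul_C]

/-- The bond operators with constant power series as entries. -/
def seriesBond (i : ZMod L) (a : Letter) : SeriesOp L := constOp (bondOp i a)

theorem bondRelations_seriesBond (hL : L ≠ 1) (i : ZMod L) : BondRelations (seriesBond i) where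
  mul_self a := by rw [seriesBond, ← map_mul, (bondRelations hL i).mul_self, map_one]
  mul_of_distinct h := by
    rw [seriesBond, seriesBond, ← map_mul, (bondRelations hL i).mul_of_distinct h, map_neg]; rfl

theorem constOp_crossTerm (J : Letter → ℂ) (i : ZMod L) (a : Letter) :
    constOp (crossTerm J (bondOp i) a) = crossTerm (weights J).J (seriesBond i) a := by
  rw [crossTerm, crossTerm, map_sum]
  refine Finset.sum_congr rfl fun b _ => ?_
  split_ifs
  · rw [map_zero]
  · rw [constOp_smul, map_mul, map_ofNat]; rfl

theorem seriesBond_lie (hL : L ≠ 1) (J : Letter → ℂ) (i : ZMod L) (a : Letter) :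
    ⁅seriesBond i a, constOp (hamiltonian L J)⁆ =
      seriesBond i a * crossTerm (weights J).J (seriesBond (i + 1)) a -
        crossTerm (weights J).J (seriesBond (i - 1)) a * seriesBond i a := by
  have := congrArg constOp (bondOp_lie_hamiltonian hL J i a)
  simp only [Ring.lie_def, map_sub, map_mul, constOp_crossTerm] at this ⊢
  exact this

/-- A generating series commuting with the Hamiltonian. Only finitely many lengths of words matter
modulo a power of the variable, as every letter has a weight divisible by it. -/
theorem exists_generating_series (hL : L ≠ 1) (J : Letter → ℂ) :
    ∃ Q : SeriesOp L, ⁅Q, constOp (hamiltonian L J)⁆ = 0 ∧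
      ∀ N, ∃ M : SeriesOp L, Q = ∑ n ∈ Finset.range N, ∑ i : ZMod L, ∑ B : Fin (n + 1) → Letter,
        (weights J).wordWeight B • constOp (bondWord bondOp i B) + (X : ℂ⟦X⟧) ^ N • M := by
  obtain ⟨T, hT⟩ := weights_T_dvd J
  have hstep : Weights.step (weights J).T (seriesBond (L := L)) =
      (X : ℂ⟦X⟧) • Weights.step T seriesBond := by rw [hT, Weights.step_smul]
  obtain ⟨F, hF⟩ := exists_eq_add_X_smul (Weights.step T (seriesBond (L := L)))
    (fun _ b => algebraMap ℂ⟦X⟧ (SeriesOp L) ((weights J).c b))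
  rw [← LinearMap.smul_apply, ← hstep] at hF
  refine ⟨∑ i, ∑ a, seriesBond i a * F (i + 1) a, ?_, fun N => ?_⟩
  · refine (weights J).lie_sum_eq_zero (bondRelations_seriesBond hL)
      (fun i b => congrFun (congrFun hF i) b) (seriesBond_lie hL J) (fun δ hδ => ?_) fun y hy => ?_
    · refine eq_zero_of_eq_X_smul (Weights.step T (seriesBond (L := L))) ?_
      rw [← LinearMap.smul_apply, ← hstep]
      exact funext₂ hδ
    · ext1 s t
      have := congrFun (congrFun hy s) t
      exact (mul_eq_zero.1 this).resolve_left (weights_t_ne_zero J)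
  · have hpow := eq_sum_pow_add hF N
    refine ⟨∑ i, ∑ a, seriesBond i a * (Weights.step T seriesBond ^ N) F (i + 1) a, ?_⟩
    have key (i : ZMod L) (a : Letter) : seriesBond i a * F (i + 1) a = ∑ n ∈ Finset.range N,
        seriesBond i a * (Weights.step (weights J).T seriesBond ^ n)
          (fun _ b => algebraMap ℂ⟦X⟧ (SeriesOp L) ((weights J).c b)) (i + 1) a +
        (X : ℂ⟦X⟧) ^ N • (seriesBond i a * (Weights.step T seriesBond ^ N) F (i + 1) a) := by
      nth_rewrite 1 [hpow]
      rw [Pi.add_apply, Pi.add_apply, Finset.sum_apply, Finset.sum_apply, mul_add, Finset.mul_sum]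
      congr 1
      rw [hstep, smul_pow, LinearMap.smul_apply, Pi.smul_apply, Pi.smul_apply, mul_smul_comm]
    simp only [key, Finset.sum_add_distrib, Finset.smul_sum]
    congr 1
    rw [Finset.sum_congr rfl fun i _ => Finset.sum_comm, Finset.sum_comm]
    simp only [Weights.sum_mul_step_pow]
    refine Finset.sum_congr rfl fun n _ => Finset.sum_congr rfl fun i _ =>
      Finset.sum_congr rfl fun B _ => ?_
    exact congrArg _ (map_bondWord (constOp (L := L) : Op L →* SeriesOp L) bondOp i B)

/-! ### Extraction of the charges -/

theorem numHoles_lt {l : ℕ} (A : Fin (l + 1) → Letter) : numHoles A < l + 1 := by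
  have h : 0 < numBlocks A := Finset.card_pos.2 ⟨Fin.last l, by simp [not_isHole_last]⟩
  have := numHoles_add_numBlocks A
  omega

/-- The contribution to a charge of the sequences of length `l` with `m` holes and the factor
`R_n`. -/
def chargePart (L : ℕ) [NeZero L] (J : Letter → ℂ) (n m l : ℕ) : Op L :=
  ∑ A : Fin l → Letter with numHoles A = m,
    (rFunc J n (fun a => blockCount A a + m) * coupling J A *
        (-Complex.I) ^ (numBlocks A - 1)) • doubling L A

theorem chargePart_eq_zero (J : Letter → ℂ) {n m l : ℕ} (h : l + 1 ≤ m) :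
    chargePart L J n m (l + 1) = 0 := by
  rw [chargePart, Finset.filter_false_of_mem, Finset.sum_empty]
  intro A _ hA
  have := numHoles_lt A
  omega

theorem charge_eq (J : Letter → ℂ) (k : ℕ) : charge L J k =
    ∑ n ∈ Finset.range k, ∑ m ∈ Finset.range k,
      if n + m < k / 2 then chargePart L J n m (k - 2 * n - m - 1) else 0 := by
  rw [← Finset.sum_subset (Finset.range_subset_range.2 (Nat.div_le_self k 2))]
  · refine Finset.sum_congr rfl fun n _ => ?_
    rw [← Finset.sum_filter]
    refine Finset.sum_congr ?_ fun m _ => rfl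
    ext m
    simp only [Finset.mem_range, Finset.mem_filter]
    omega
  · intro n _ hn
    refine Finset.sum_eq_zero fun m _ => if_neg ?_
    rw [Finset.mem_range] at hn
    omega

theorem sum_extract_wordWeight (J : Letter → ℂ) (k l : ℕ) (hl : l < k) :
    ∑ B : Fin (l + 1) → Letter, extract J (k - 1) ((weights J).wordWeight B) • doubling L B =
      -Complex.I • ∑ n ∈ Finset.range k, ∑ m ∈ Finset.range k,
        if l + 1 + m + 2 * n = k - 1 then chargePart L J n m (l + 1) else 0 := by
  have e (B : Fin (l + 1) → Letter) :
      extract J (k - 1) ((weights J).wordWeight B) • doubling L B =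
      -Complex.I • ∑ n ∈ Finset.range k, if l + 1 + numHoles B + 2 * n = k - 1 then
        (rFunc J n (fun a => blockCount B a + numHoles B) * coupling J B *
          (-Complex.I) ^ (numBlocks B - 1)) • doubling L B else 0 := by
    have hB : 0 < numBlocks B := by
      have := numHoles_lt B
      have := numHoles_add_numBlocks B
      omega
    rw [extract_wordWeight, Nat.sub_add_cancel (by omega), Finset.sum_smul, Finset.smul_sum]
    refine Finset.sum_congr rfl fun n _ => ?_
    split_ifs
    · rw [smul_smul, ← mul_pow_sub_one hB.ne']
      congr 1
      ring
    · rw [zero_smul, smul_zero]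
  simp only [e]
  rw [← Finset.smul_sum, Finset.sum_comm]
  congr 1
  refine Finset.sum_congr rfl fun n _ => ?_
  rw [← Finset.sum_fiberwise_of_maps_to (t := Finset.range k) (g := numHoles)
    (fun B _ => Finset.mem_range.2 (by have := numHoles_lt B; omega))]
  refine Finset.sum_congr rfl fun m _ => ?_
  split_ifs with h
  · refine Finset.sum_congr rfl fun B hB => ?_
    rw [(Finset.mem_filter.1 hB).2, if_pos h]
  · refine Finset.sum_eq_zero fun B hB => ?_
    rw [(Finset.mem_filter.1 hB).2, if_neg h]

/-- The restriction `n + m < k / 2` is automatic: a nonempty sequence has fewer holes than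
letters. -/
theorem sum_chargePart (J : Letter → ℂ) (k : ℕ) :
    ∑ l ∈ Finset.range k, ∑ n ∈ Finset.range k, ∑ m ∈ Finset.range k,
        (if l + 1 + m + 2 * n = k - 1 then chargePart L J n m (l + 1) else 0) = charge L J k := by
  rw [Finset.sum_comm, charge_eq]
  refine Finset.sum_congr rfl fun n _ => ?_
  rw [Finset.sum_comm]
  refine Finset.sum_congr rfl fun m _ => ?_
  by_cases h : 2 * n + m + 2 ≤ k
  · obtain ⟨l, rfl⟩ := Nat.exists_eq_add_of_le h
    rw [Finset.sum_eq_single l, if_pos (by omega),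
      show 2 * n + m + 2 + l - 2 * n - m - 1 = l + 1 by omega]
    · split_ifs with h'
      · rfl
      · exact chargePart_eq_zero J (by omega)
    · intro l' _ hl'
      rw [if_neg (by omega)]
    · intro hl
      exact absurd (Finset.mem_range.2 (by omega)) hl
  · rw [if_neg (by omega)]
    exact Finset.sum_eq_zero fun l _ => if_neg (by omega)

theorem charge_lie_hamiltonian (J : Letter → ℂ) (k : ℕ) (hk : 2 ≤ k) :
    ⁅charge L J k, hamiltonian L J⁆ = 0 := by
  by_cases hL : L = 1
  · subst hL
    exact lie_hamiltonian_one J _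
  obtain ⟨Q, hQ, hsum⟩ := exists_generating_series hL J
  obtain ⟨M, hM⟩ := hsum k
  have hcoeff : coeffOp (extract J (k - 1)) Q = -Complex.I • charge L J k := by
    have hM0 : coeffOp (extract J (k - 1)) ((X : ℂ⟦X⟧) ^ k • M) = 0 := by
      ext s t
      exact extract_eq_zero J (k - 1) k (by omega) (M s t)
    rw [hM, map_add, hM0, add_zero, map_sum, ← sum_chargePart, Finset.smul_sum]
    refine Finset.sum_congr rfl fun l hl => ?_
    rw [← sum_extract_wordWeight J k l (Finset.mem_range.1 hl), Finset.sum_comm, map_sum]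
    refine Finset.sum_congr rfl fun B _ => ?_
    rw [doubling_eq, Finset.smul_sum, map_sum]
    exact Finset.sum_congr rfl fun i _ => coeffOp_smul_constOp _ _ _
  have h := congrArg (coeffOp (extract J (k - 1))) hQ
  rw [Ring.lie_def, map_sub, coeffOp_mul_constOp, coeffOp_constOp_mul, hcoeff, map_zero,
    smul_mul_assoc, mul_smul_comm, ← smul_sub] at h
  exact (smul_eq_zero.1 h).resolve_left (neg_ne_zero.2 Complex.I_ne_zero)

end Generating

end XYZChain

end

theorem mainTheorem3 (L : ℕ) [NeZero L] (J : XYZChain.Letter → ℂ) (k : ℕ) (hk : 2 ≤ k) :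
    ⁅XYZChain.charge L J k, XYZChain.hamiltonian L J⁆ = 0 :=
  XYZChain.charge_lie_hamiltonian J k hk
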